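/- Let $\mathbb F$ be a field of characteristic $p\ge 0$, let $n\ge 1$, and let $\mathbb U_1,\dots,\mathbb U_n$ be finite sets with $|\mathbb U_a|>1$ for all $a$. Put $\mathbb X=\prod_{a=1}^n\mathbb U_a$ and $\mathbb E=\{0,1\}^n$. For $\mathbf g\in\mathbb E$ write $\mathbb g=\{a:\mathbf g_a=1\}$, and let $R_{\mathbf g}$ be the set of pairs $(\mathbf y,\mathbf z)\in\mathbb X\times\mathbb X$ with $\{a:\mathbf y_a\ne\mathbf z_a\}=\mathbb g$. Then $(\mathbb X,\{R_{\mathbf g}\}_{\mathbf g\in\mathbb E})$ is the factorial association scheme, that is, the direct product of the trivial schemes on $\mathbb U_1,\dots,\mathbb U_n$. Let $k_{\mathbf g}$ be the valency of $R_{\mathbf g}$, so $k_{\mathbf g}=\prod_{a\in\mathbb g}(|\mathbb U_a|-1)$. Fix $\mathbf x\in\mathbb X$. Let $A_{\mathbf g}$ be the adjacency matrix of $R_{\mathbf g}$ over $\mathbb F$, and let $E^*_{\mathbf g}$ be the diagonal $0$-$1$ matrix whose $(\mathbf y,\mathbf y)$ entry is $1$ exactly when $(\mathbf x,\mathbf y)\in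 R_{\mathbf g}$. Let $\mathbb T$ be the subalgebra of the algebra of $\mathbb X\times\mathbb X$ matrices over $\mathbb F$ generated by all $A_{\mathbf g}$ and $E^*_{\mathbf g}$ (the Terwilliger $\mathbb F$-algebra of the scheme with respect to $\mathbf x$). Let $\mathbb P$ be the set of triples $(\mathbf a,\mathbf b,\mathbf c)\in\mathbb E^3$ with $$\mathbb a\,\triangle\,\mathbb c\ \subseteq\ \mathbb b\ \subseteq\ (\mathbb a\,\triangle\,\mathbb c)\cup\{i\in\mathbb a\cap\mathbb c:\ |\mathbb U_i|>2\},$$ and for $(\mathbf a,\mathbf b,\mathbf c)\in\mathbb P$ put $$B_{\mathbf a,\mathbf b,\mathbf c}=\sum_{\mathbf j\in\mathbb E,\ \mathbb a\triangle\mathbb c\subseteq\mathbb j\subseteq\mathbb b}E^*_{\mathbf a}A_{\mathbf j}E^*_{\mathbf c}\in\mathbb T .$$ Let $\mathbb I$ be the $\mathbb F$-linear span of all $B_{\mathbf a,\mathbf b,\mathbf c}$ with $(\mathbf a,\mathbf b,\mathbf c)\in\mathbb P$ and $p\mid k_{\mathbf b}$. Let $\mathrm{Rad}(\mathbb T)$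 be the Jacobson radical of $\mathbb T$, that is, the sum of all nilpotent two-sided ideals of $\mathbb T$. Then $\mathrm{Rad}(\mathbb T)=\mathbb I$. Moreover, $\mathrm{Rad}(\mathbb T)$ is nilpotent, and its nilpotent index, the least integer $g\ge1$ such that $e_1e_2\cdots e_g=0$ for all $e_1,\dots,e_g\in\mathrm{Rad}(\mathbb T)$, equals $$2\,\bigl|\{a\in\{1,\dots,n\}:\ p\mid |\mathbb U_a|-1\}\bigr|+1 .$$ -/

import Mathlib

/-- An association scheme `(X, {R_g : g ∈ E})` on a set `X`: a partition of `X × X` into nonempty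
relations `R_g` indexed by `E`, satisfying the three axioms of a scheme. -/
structure AssocScheme (X E : Type*) where
  /-- the relations `R_g` -/
  R : E → Set (X × X)
  R_nonempty : ∀ g, (R g).Nonempty
  R_partition : ∀ z : X × X, ∃! g, z ∈ R g
  /-- some relation is the diagonal -/
  diag : ∃! g, R g = {z : X × X | z.1 = z.2}
  /-- the relations are closed under transposition -/
  transpose : ∀ g, ∃! g', R g' = {z : X × X | (z.2, z.1) ∈ R g}
  /-- the intersection numbers are well defined -/
  regular : ∀ g h i, ∃ c : ℕ, ∀ x y, (x, y) ∈ R i →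
    Nat.card {a : X // (x, a) ∈ R g ∧ (a, y) ∈ R h} = c

namespace AssocScheme

noncomputable section

variable {X E : Type*}

/-- The index `0_S` of the diagonal relation. -/
def zero (S : AssocScheme X E) : E := S.diag.choose

/-- The index `g*` of the transpose of `R_g`. -/
def star (S : AssocScheme X E) (g : E) : E := (S.transpose g).choose

/-- The intersection number `p_{g,h}^i`. -/
def interNum (S : AssocScheme X E) (g h i : E) : ℕ := (S.regular g h i).choose

/-- The valency `k_g = p_{g,g*}^{0}`. -/
def valency (S : AssocScheme X E) (g : E) : ℕ := S.interNum g (S.star g) S.zero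

open scoped Classical in
/-- The adjacency matrix `A_g` over `F`. -/
def adjacency (F : Type*) [Field F] (S : AssocScheme X E) (g : E) : Matrix X X F :=
  Matrix.of fun y z => if (y, z) ∈ S.R g then 1 else 0

/-- The dual idempotent `E*_g(x)` over `F`. -/
def dualIdempotent (F : Type*) [Field F] [DecidableEq X] (S : AssocScheme X E) (x : X) (g : E) :
    Matrix X X F :=
  open scoped Classical in
  Matrix.diagonal fun y => if (x, y) ∈ S.R g then 1 else 0

/-- The Terwilliger `F`-algebra `T(x)`, generated by all `A_g` and all `E*_g(x)`. -/
def terwilliger (F : Type*) [Field F] [Fintype X] [DecidableEq X] (S : AssocScheme X E) (x : X) :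
    Subalgebra F (Matrix X X F) :=
  Algebra.adjoin F (Set.range (S.adjacency F) ∪ Set.range (S.dualIdempotent F x))

/-- `A_g` as an element of `T(x)`. -/
def adjT (F : Type*) [Field F] [Fintype X] [DecidableEq X] (S : AssocScheme X E) (x : X) (g : E) :
    S.terwilliger F x :=
  ⟨S.adjacency F g, Algebra.subset_adjoin (Or.inl ⟨g, rfl⟩)⟩

/-- `E*_g(x)` as an element of `T(x)`. -/
def dualT (F : Type*) [Field F] [Fintype X] [DecidableEq X] (S : AssocScheme X E) (x : X) (g : E) :
    S.terwilliger F x :=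
  ⟨S.dualIdempotent F x g, Algebra.subset_adjoin (Or.inr ⟨g, rfl⟩)⟩

/-- The trivial scheme on a finite set `U` with more than one element: `R_0` is the diagonal and
`R_1` is its complement. -/
def trivialScheme (U : Type*) [Finite U] [Nontrivial U] : AssocScheme U (Fin 2) where
  R g := if g = 0 then {z : U × U | z.1 = z.2} else {z : U × U | z.1 ≠ z.2}
  R_nonempty g := by
    obtain ⟨a, b, hab⟩ := exists_pair_ne U
    split_ifs
    · exact ⟨(a, a), rfl⟩
    · exact ⟨(a, b), hab⟩
  R_partition z := by
    by_cases h : z.1 = z.2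
    · refine ⟨0, by simpa using h, fun g hg => ?_⟩
      fin_cases g <;> simp_all
    · refine ⟨1, by simpa using h, fun g hg => ?_⟩
      fin_cases g <;> simp_all
  diag := by
    refine ⟨0, by simp, fun g hg => ?_⟩
    obtain ⟨a⟩ := (inferInstance : Nonempty U)
    fin_cases g
    · rfl
    · have : (a, a) ∈ {z : U × U | z.1 = z.2} := rfl
      rw [← hg] at this
      simp at this
  transpose g := by
    obtain ⟨a, b, hab⟩ := exists_pair_ne U
    refine ⟨g, ?_, fun g' hg' => ?_⟩
    · ext z
      fin_cases g <;> simp [eq_comm]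
    · have h := Set.ext_iff.1 hg' (a, a)
      clear hg'
      fin_cases g <;> fin_cases g' <;> simp at h ⊢
  regular g h i := by
    have key : ∀ x y x' y' : U, (x = y ↔ x' = y') →
        ∃ σ : Equiv.Perm U, σ x = x' ∧ σ y = y' := by
      classical
      intro x y x' y' H
      by_cases hxy : x = y
      · subst hxy
        obtain rfl := H.1 rfl
        exact ⟨Equiv.swap x x', by simp, by simp⟩
      · have hxy' : x' ≠ y' := fun e => hxy (H.2 e)
        refine ⟨(Equiv.swap x x').trans (Equiv.swap (Equiv.swap x x' y) y'), ?_, by simp⟩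
        have : x' ≠ Equiv.swap x x' y := by
          intro e
          apply hxy
          apply (Equiv.swap x x').injective
          rw [Equiv.swap_apply_left]
          exact e
        simp [Equiv.swap_apply_of_ne_of_ne this hxy']
    have inv : ∀ (σ : Equiv.Perm U) (g : Fin 2) (a b : U),
        ((σ a, σ b) ∈ (if g = 0 then {z : U × U | z.1 = z.2} else {z : U × U | z.1 ≠ z.2})) ↔
        ((a, b) ∈ (if g = 0 then {z : U × U | z.1 = z.2} else {z : U × U | z.1 ≠ z.2})) := by
      intro σ g a b
      split_ifs <;> simp
    by_cases hne : ∃ x y : U, (x, y) ∈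
        (if i = 0 then {z : U × U | z.1 = z.2} else {z : U × U | z.1 ≠ z.2})
    · obtain ⟨x, y, hxy⟩ := hne
      refine ⟨_, fun x' y' h' => (?_ : _ = Nat.card {a : U //
        (x, a) ∈ (if g = 0 then {z : U × U | z.1 = z.2} else {z : U × U | z.1 ≠ z.2}) ∧
        (a, y) ∈ (if h = 0 then {z : U × U | z.1 = z.2} else {z : U × U | z.1 ≠ z.2})})⟩
      obtain ⟨σ, rfl, rfl⟩ := key x y x' y' (by
        split_ifs at hxy h' <;> simp_all)
      refine (Nat.card_congr (σ.subtypeEquiv fun a => ?_)).symm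
      rw [inv, inv]
    · exact ⟨0, fun x y hxy => (hne ⟨x, y, hxy⟩).elim⟩

/-- The direct product of finitely many schemes: `R_i` consists of the pairs of tuples related
coordinatewise by the relations `R_{i_h}`. -/
def directProduct {ι : Type*} [Finite ι] {Y D : ι → Type*} (S : ∀ h, AssocScheme (Y h) (D h)) :
    AssocScheme (∀ h, Y h) (∀ h, D h) where
  R i := {z | ∀ h, (z.1 h, z.2 h) ∈ (S h).R (i h)}
  R_nonempty i :=
    ⟨(fun h => ((S h).R_nonempty (i h)).some.1, fun h => ((S h).R_nonempty (i h)).some.2),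
      fun h => ((S h).R_nonempty (i h)).some_mem⟩
  R_partition z := by
    choose g hg hu using fun h => (S h).R_partition (z.1 h, z.2 h)
    exact ⟨g, hg, fun g' hg' => funext fun h => hu h _ (hg' h)⟩
  diag := by
    choose g hg _ using fun h => (S h).diag
    have hR : {z : (∀ h, Y h) × (∀ h, Y h) | ∀ h, (z.1 h, z.2 h) ∈ (S h).R (g h)} =
        {z | z.1 = z.2} := by
      ext z
      simp [hg, funext_iff]
    refine ⟨g, hR, fun g' hg' => funext fun h => ?_⟩
    let w : ∀ h, Y h := fun h => ((S h).R_nonempty (g h)).some.1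
    have h1 : (w, w) ∈ {z : (∀ h, Y h) × (∀ h, Y h) | ∀ h, (z.1 h, z.2 h) ∈ (S h).R (g' h)} := by
      rw [hg']
      rfl
    have h2 : (w, w) ∈ {z : (∀ h, Y h) × (∀ h, Y h) | ∀ h, (z.1 h, z.2 h) ∈ (S h).R (g h)} := by
      rw [hR]
      rfl
    exact ((S h).R_partition (w h, w h)).unique (h1 h) (h2 h)
  transpose g := by
    choose t ht _ using fun h => (S h).transpose (g h)
    have hR : {z : (∀ h, Y h) × (∀ h, Y h) | ∀ h, (z.1 h, z.2 h) ∈ (S h).R (t h)} =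
        {z | (z.2, z.1) ∈
          {z : (∀ h, Y h) × (∀ h, Y h) | ∀ h, (z.1 h, z.2 h) ∈ (S h).R (g h)}} := by
      ext z
      simp [ht]
    refine ⟨t, hR, fun t' ht' => funext fun h => ?_⟩
    let z : (∀ h, Y h) × (∀ h, Y h) := (fun h => ((S h).R_nonempty (t h)).some.1,
      fun h => ((S h).R_nonempty (t h)).some.2)
    have h2 : z ∈ {z : (∀ h, Y h) × (∀ h, Y h) | ∀ h, (z.1 h, z.2 h) ∈ (S h).R (t h)} :=
      fun h => ((S h).R_nonempty (t h)).some_mem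
    have h1 : z ∈ {z : (∀ h, Y h) × (∀ h, Y h) | ∀ h, (z.1 h, z.2 h) ∈ (S h).R (t' h)} := by
      rw [ht', ← hR]
      exact h2
    exact ((S h).R_partition (z.1 h, z.2 h)).unique (h1 h) (h2 h)
  regular g h i := by
    have := Fintype.ofFinite ι
    choose c hc using fun j => (S j).regular (g j) (h j) (i j)
    refine ⟨∏ j, c j, fun x y hxy => ?_⟩
    rw [← Finset.prod_congr rfl fun j _ => hc j (x j) (y j) (hxy j), ← Nat.card_pi]
    refine Nat.card_congr ((Equiv.subtypeEquivRight fun a => ?_).trans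
      (Equiv.subtypePiEquivPi (p := fun j (b : Y j) =>
        (x j, b) ∈ (S j).R (g j) ∧ (b, y j) ∈ (S j).R (h j))))
    simp [forall_and]

end

end AssocScheme

namespace NilpotentIdeal

variable {A : Type*} [Ring A]

/-- All products `e_1 e_2 ⋯ e_g` of `g` elements of `I` vanish. -/
def ProductsVanish (I : TwoSidedIdeal A) (g : ℕ) : Prop :=
  ∀ e : Fin g → A, (∀ h, e h ∈ I) → (List.ofFn e).prod = 0

/-- `I` is a nilpotent two-sided ideal. -/
def IsNil (I : TwoSidedIdeal A) : Prop := ∃ g : ℕ, 0 < g ∧ ProductsVanish I g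

/-- `I` is nilpotent and `g` is its nilpotent index, the least positive integer such that all
products of `g` elements of `I` vanish. -/
def HasIndex (I : TwoSidedIdeal A) (g : ℕ) : Prop :=
  IsLeast {m : ℕ | 0 < m ∧ ProductsVanish I m} g

/-- The Jacobson radical of a finite-dimensional algebra: the sum of all nilpotent two-sided
ideals. -/
def Rad (A : Type*) [Ring A] : TwoSidedIdeal A := sSup {I | IsNil I}

end NilpotentIdeal

namespace FactorialScheme

noncomputable section

variable {n : ℕ} (U : Fin n → Type*) [∀ a, Fintype (U a)] [∀ a, Nontrivial (U a)]

/-- The factorial scheme of the trivial schemes on `U_1, …, U_n`. -/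
def scheme : AssocScheme (∀ a, U a) (Fin n → Fin 2) :=
  AssocScheme.directProduct fun a => AssocScheme.trivialScheme (U a)

/-- The set of coordinates in which a `0`-`1` tuple has entry `1`. -/
def ones (g : Fin n → Fin 2) : Finset (Fin n) := Finset.univ.filter fun a => g a = 1

/-- `V° = {a ∈ V : |U_a| > 2}`. -/
def big (V : Finset (Fin n)) : Finset (Fin n) := V.filter fun a => 2 < Fintype.card (U a)

/-- `(g, h, i) ∈ P`. -/
def InP (g h i : Fin n → Fin 2) : Prop :=
  symmDiff (ones g) (ones i) ⊆ ones h ∧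
    ones h ⊆ symmDiff (ones g) (ones i) ∪ big U (ones g ∩ ones i)

variable [∀ a, DecidableEq (U a)] (F : Type*) [Field F] (x : ∀ a, U a)

/-- The Terwilliger `F`-algebra `T = T(x)` of the factorial scheme. -/
abbrev T : Subalgebra F (Matrix (∀ a, U a) (∀ a, U a) F) := (scheme U).terwilliger F x

/-- `B_{g,h,i}`, the sum of `E*_g A_j E*_i` over the tuples `j` with
`ones g ∆ ones i ⊆ ones j ⊆ ones h`. -/
def B (g h i : Fin n → Fin 2) : T U F x :=
  ∑ j ∈ Finset.univ.filter (fun j : Fin n → Fin 2 =>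
      symmDiff (ones g) (ones i) ⊆ ones j ∧ ones j ⊆ ones h),
    (scheme U).dualT F x g * (scheme U).adjT F x j * (scheme U).dualT F x i

/-- The `F`-span of the `B_{g,h,i}` with `(g, h, i) ∈ P` and `p ∣ k_h`. -/
def spanI (p : ℕ) : Submodule F (T U F x) :=
  Submodule.span F {M | ∃ g h i : Fin n → Fin 2,
    InP U g h i ∧ p ∣ (scheme U).valency h ∧ M = B U F x g h i}

end

end FactorialScheme

/-!
The adjacency matrices and dual idempotents of the factorial scheme are Kronecker products (`kron`)
of those of the trivial schemes, and `B g h i` is the Kronecker product of matrices `factorB` that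
depend only on the entries of `g`, `h`, `i` in one coordinate. So the Terwilliger algebra `T` is
the Kronecker product of the Terwilliger algebras `factorAlg` of the trivial schemes. The latter
are spanned by the diagonal idempotents of the blocks `{v}` and `V \ {v}` and by the four all-ones
blocks.

If `|V| - 1` is invertible in the field, `factorAlg` is a sum of matrix algebras
(`separates_of_ne_zero`). Otherwise its radical `factorRad` is spanned by the all-ones blocks
`(0, 1)`, `(1, 0)`, `(1, 1)`, the quotient is split commutative (`separates_of_eq_zero`), and
`factorRad ^ 3 = 0`, whereas `(1, 0) * (0, 1) = (1, 1)` is nonzero.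

Powers of the `factorRad` give a multiplicative filtration of `T` by total degree (`filtration`).
Its zeroth term is `T` (`mem_T_iff`), its first term is the span of the statement
(`mem_spanI_iff`), and the terms of degree more than twice the number of coordinates with
`p ∣ |U a| - 1` vanish (`filtration_eq_bot`). Hence the first term is a nilpotent ideal. The product
over those coordinates of the blocks `(1, 0)` and `(0, 1)` shows that the bound on its index is
sharp (`exists_list_prod_eq`). The first term contains every nilpotent ideal because being split
modulo an ideal, in the form `Separates`, passes to Kronecker products (`separates_kron`), and an
element outside the ideal can then be multiplied into a nonzero multiple of an idempotent plus an
element of the ideal (`Separates.mem_of_forall_isNilpotent`).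
-/

namespace FactorialScheme

/-! ### Kronecker products of families of matrices -/

section Tensor

variable {ι : Type*} [Fintype ι] {F : Type*} [Field F] {U : ι → Type*}

/-- The Kronecker product of a finite family of square matrices, indexed by tuples; it is
multilinear in the factors. -/
def kron : MultilinearMap F (fun i => Matrix (U i) (U i) F)
    (Matrix (∀ i, U i) (∀ i, U i) F) where
  toFun f := Matrix.of fun y z => ∏ i, f i (y i) (z i)
  map_update_add' f i A B := by
    ext y z
    exact ((MultilinearMap.mkPiAlgebra F ι F).compLinearMap
      fun i => Matrix.entryLinearMap F F (y i) (z i)).map_update_add f i A B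
  map_update_smul' f i c A := by
    ext y z
    exact ((MultilinearMap.mkPiAlgebra F ι F).compLinearMap
      fun i => Matrix.entryLinearMap F F (y i) (z i)).map_update_smul f i c A

theorem kron_apply (f : ∀ i, Matrix (U i) (U i) F) (y z : ∀ i, U i) :
    kron f y z = ∏ i, f i (y i) (z i) := rfl

theorem kron_mul [DecidableEq ι] [∀ i, Fintype (U i)] (f g : ∀ i, Matrix (U i) (U i) F) :
    kron f * kron g = kron fun i => f i * g i := by
  ext y z
  simp only [Matrix.mul_apply, kron_apply, Finset.prod_univ_sum, Fintype.piFinset_univ,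
    Finset.prod_mul_distrib]

theorem kron_diagonal [∀ i, DecidableEq (U i)] (d : ∀ i, U i → F) :
    kron (fun i => Matrix.diagonal (d i)) = Matrix.diagonal fun y => ∏ i, d i (y i) := by
  ext y z
  rw [kron_apply]
  by_cases h : y = z
  · subst h
    simp
  · obtain ⟨i, hi⟩ := Function.ne_iff.1 h
    rw [Matrix.diagonal_apply_ne _ h]
    exact Finset.prod_eq_zero (Finset.mem_univ i) (Matrix.diagonal_apply_ne _ hi)

theorem kron_one [∀ i, DecidableEq (U i)] :
    kron (fun i => (1 : Matrix (U i) (U i) F)) = 1 := by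
  simpa using kron_diagonal (F := F) fun i (_ : U i) => 1

theorem kron_ne_zero {f : ∀ i, Matrix (U i) (U i) F} (hf : ∀ i, f i ≠ 0) : kron f ≠ 0 := by
  have h : ∀ i, ∃ y z, f i y z ≠ 0 := fun i => by
    by_contra! hc
    exact hf i (Matrix.ext hc)
  choose y z hyz using h
  intro h0
  exact Finset.prod_ne_zero_iff.2 (fun i _ => hyz i) (congrFun₂ h0 y z)

theorem ne_zero_of_kron_ne_zero {f : ∀ i, Matrix (U i) (U i) F} (hf : kron f ≠ 0) (i : ι) :
    f i ≠ 0 := fun h => hf (kron.map_coord_zero i h)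

/-- Multilinearity: a product of elements of spans lies in the span of the products. -/
theorem kron_mem_span (S : ∀ i, Set (Matrix (U i) (U i) F)) (f : ∀ i, Matrix (U i) (U i) F)
    (hf : ∀ i, f i ∈ Submodule.span F (S i)) :
    kron f ∈ Submodule.span F {M | ∃ g, (∀ i, g i ∈ S i) ∧ kron g = M} := by
  classical
  suffices H : ∀ (s : Finset ι) (f : ∀ i, Matrix (U i) (U i) F),
      (∀ i ∈ s, f i ∈ Submodule.span F (S i)) → (∀ i ∉ s, f i ∈ S i) →
      kron f ∈ Submodule.span F {M | ∃ g, (∀ i, g i ∈ S i) ∧ kron g = M} from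
    H Finset.univ f (fun i _ => hf i) fun i hi => (hi (Finset.mem_univ i)).elim
  intro s
  induction s using Finset.induction_on with
  | empty => exact fun f _ h => Submodule.subset_span ⟨f, fun i => h i (by simp), rfl⟩
  | insert i s his ih =>
    intro f h1 h2
    have key : ∀ A ∈ Submodule.span F (S i), kron (Function.update f i A) ∈
        Submodule.span F {M | ∃ g, (∀ i, g i ∈ S i) ∧ kron g = M} := by
      intro A hA
      induction hA using Submodule.span_induction with
      | mem A hA =>
        refine ih _ (fun j hj => ?_) fun j hj => ?_
        · rw [Function.update_of_ne (by rintro rfl; exact his hj)]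
          exact h1 j (Finset.mem_insert_of_mem hj)
        · by_cases hji : j = i
          · subst hji
            simpa using hA
          · rw [Function.update_of_ne hji]
            exact h2 j (by simp [hji, hj])
      | zero => rw [kron.map_update_zero]; exact zero_mem _
      | add A B _ _ hA hB => rw [kron.map_update_add]; exact add_mem hA hB
      | smul c A _ hA => rw [kron.map_update_smul]; exact Submodule.smul_mem _ c hA
    simpa using key (f i) (h1 i (Finset.mem_insert_self i s))

end Tensor

/-! ### Powers of an ideal and separating sets -/

section Filtration

variable {F A : Type*} [Field F] [Ring A] [Algebra F A]

/-- The powers of an ideal `R` of an algebra `L`, both given as subspaces of an ambient algebra: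
the zeroth power is `L` itself (`R ^ 0` would be the line of scalars). -/
def idealPow (L R : Submodule F A) (w : ℕ) : Submodule F A := if w = 0 then L else R ^ w

/-- `R` is a two-sided ideal of the (unital) algebra `L`. -/
structure IsIdealOf (R L : Submodule F A) : Prop where
  one_mem : 1 ∈ L
  mul_le : L * L ≤ L
  le : R ≤ L
  left : L * R ≤ R
  right : R * L ≤ R

theorem idealPow_mul_le {L R : Submodule F A} (h : IsIdealOf R L) (a b : ℕ) :
    idealPow L R a * idealPow L R b ≤ idealPow L R (a + b) := by
  unfold idealPow
  rcases a with _ | a <;> rcases b with _ | b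
  · simpa using h.mul_le
  · simp only [if_true, zero_add, Nat.add_eq_zero_iff, one_ne_zero, and_false, if_false]
    rw [pow_succ', ← mul_assoc]
    exact mul_le_mul_left h.left _
  · simp only [if_true, add_zero, Nat.add_eq_zero_iff, one_ne_zero, and_false, if_false]
    rw [pow_succ, mul_assoc]
    exact mul_le_mul_right h.right _
  · simp only [Nat.add_eq_zero_iff, one_ne_zero, and_false, if_false, ← pow_add, le_refl]

theorem idealPow_le {L R : Submodule F A} (h : IsIdealOf R L) (w : ℕ) : idealPow L R w ≤ L := by
  induction w with
  | zero => simp [idealPow]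
  | succ w ih =>
    have h1 : idealPow L R 1 ≤ L := by simpa [idealPow] using h.le
    rcases w with _ | w
    · exact h1
    · have : idealPow L R (w + 1 + 1) = idealPow L R (w + 1) * idealPow L R 1 := by
        simp [idealPow, pow_succ]
      rw [this]
      exact (mul_le_mul' ih h1).trans h.mul_le

theorem idealPow_succ_le {L R : Submodule F A} (h : IsIdealOf R L) (w : ℕ) :
    idealPow L R (w + 1) ≤ R := by
  rcases w with _ | w
  · simp [idealPow]
  · have : idealPow L R (w + 1 + 1) = idealPow L R (w + 1) * R := by
      simp [idealPow, pow_succ]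
    rw [this]
    exact (mul_le_mul_left (idealPow_le h _) _).trans h.left

/-- `S` spans a complement of `R` in `L`, possibly non-directly, and each nonzero element of `S`
can be isolated from the rest of `S` by two-sided multiplication and turned into a nonzero
idempotent. Matrix units of a split semisimple algebra have this property. -/
structure Separates (S : Set A) (L R : Submodule F A) : Prop where
  sup_eq : Submodule.span F S ⊔ R = L
  isolate : ∀ s ∈ S, s ≠ 0 → ∃ u ∈ L, ∃ v ∈ L, ∃ q, q ≠ 0 ∧ q * q = q ∧ u * s * v = q ∧
    ∀ t ∈ S, t ≠ s → u * t * v = 0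

end Filtration

/-! ### The filtration of a Kronecker product -/

section TensorFiltration

variable {ι : Type*} [Fintype ι] {F : Type*} [Field F] {U : ι → Type*}
  [∀ i, Fintype (U i)] [∀ i, DecidableEq (U i)]

/-- The total-degree filtration of a Kronecker product of algebras `L i` with ideals `R i`: the
`m`-th term is spanned by the products whose factors lie in powers of the `R i` of total
exponent at least `m`. -/
def kronFiltration (L R : ∀ i, Submodule F (Matrix (U i) (U i) F)) (m : ℕ) :
    Submodule F (Matrix (∀ i, U i) (∀ i, U i) F) :=
  Submodule.span F {M | ∃ w : ι → ℕ, m ≤ ∑ i, w i ∧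
    ∃ f, (∀ i, f i ∈ idealPow (L i) (R i) (w i)) ∧ kron f = M}

variable {L R : ∀ i, Submodule F (Matrix (U i) (U i) F)}

theorem kron_mem_zero {f : ∀ i, Matrix (U i) (U i) F} (hf : ∀ i, f i ∈ L i) :
    kron f ∈ kronFiltration L R 0 :=
  Submodule.subset_span ⟨fun _ => 0, Nat.zero_le _, f, by simpa [idealPow] using hf, rfl⟩

theorem kron_mem_one {f : ∀ i, Matrix (U i) (U i) F} (hf : ∀ i, f i ∈ L i) {i : ι}
    (hi : f i ∈ R i) : kron f ∈ kronFiltration L R 1 := by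
  classical
  refine Submodule.subset_span ⟨Pi.single i 1, by simp, f, fun j => ?_, rfl⟩
  by_cases h : j = i
  · subst h
    simpa [idealPow] using hi
  · simpa [idealPow, Pi.single_eq_of_ne h] using hf j

theorem kronFiltration_antitone {m l : ℕ} (h : m ≤ l) :
    kronFiltration L R l ≤ kronFiltration L R m :=
  Submodule.span_mono fun _ ⟨w, hw, hM⟩ => ⟨w, h.trans hw, hM⟩

theorem kronFiltration_mul_le [DecidableEq ι] (h : ∀ i, IsIdealOf (R i) (L i)) (m l : ℕ) :
    kronFiltration L R m * kronFiltration L R l ≤ kronFiltration L R (m + l) := by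
  unfold kronFiltration
  rw [Submodule.span_mul_span, Submodule.span_le]
  rintro _ ⟨_, ⟨w, hw, f, hf, rfl⟩, _, ⟨w', hw', g, hg, rfl⟩, rfl⟩
  refine Submodule.subset_span ⟨w + w', ?_, _, fun i => ?_, (kron_mul f g).symm⟩
  · simpa [Finset.sum_add_distrib] using add_le_add hw hw'
  · exact idealPow_mul_le (h i) _ _ (Submodule.mul_mem_mul (hf i) (hg i))

theorem one_mem_kronFiltration (h : ∀ i, IsIdealOf (R i) (L i)) :
    1 ∈ kronFiltration L R 0 := by
  rw [← kron_one]
  exact kron_mem_zero fun i => (h i).one_mem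

/-- If `R i ^ (e i + 1) = 0` for all `i`, a product of total degree above `∑ e i` has a vanishing
factor. -/
theorem kronFiltration_eq_bot (e : ι → ℕ) (he : ∀ i, R i ^ (e i + 1) = ⊥) {m : ℕ}
    (hm : ∑ i, e i < m) : kronFiltration L R m = ⊥ := by
  rw [kronFiltration, Submodule.span_eq_bot]
  rintro _ ⟨w, hw, f, hf, rfl⟩
  obtain ⟨i, -, hi⟩ := Finset.exists_lt_of_sum_lt (hm.trans_le hw)
  refine kron.map_coord_zero i ?_
  have := hf i
  rw [idealPow, if_neg (by omega)] at this
  obtain ⟨c, hc⟩ := Nat.exists_eq_add_of_le (Nat.succ_le_of_lt hi)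
  rw [hc, pow_add, Nat.succ_eq_add_one, he i, Submodule.bot_mul] at this
  exact (Submodule.mem_bot F).1 this

theorem list_prod_mem_kronFiltration [DecidableEq ι] (h : ∀ i, IsIdealOf (R i) (L i))
    (l : List (Matrix (∀ i, U i) (∀ i, U i) F)) (hl : ∀ M ∈ l, M ∈ kronFiltration L R 1) :
    l.prod ∈ kronFiltration L R l.length := by
  induction l with
  | nil => exact one_mem_kronFiltration h
  | cons M l ih =>
    rw [List.prod_cons, List.length_cons, add_comm]
    exact kronFiltration_mul_le h _ _ (Submodule.mul_mem_mul (hl M (by simp))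
      (ih fun N hN => hl N (by simp [hN])))

theorem separates_kron [DecidableEq ι] (h : ∀ i, IsIdealOf (R i) (L i))
    {S : ∀ i, Set (Matrix (U i) (U i) F)}
    (hS : ∀ i, Separates (S i) (L i) (R i)) :
    Separates {M | ∃ f, (∀ i, f i ∈ S i) ∧ kron f = M}
      (kronFiltration L R 0) (kronFiltration L R 1) where
  sup_eq := by
    have hSL : ∀ i, S i ⊆ L i := fun i s hs => by
      rw [SetLike.mem_coe, ← (hS i).sup_eq]
      exact Submodule.mem_sup_left (Submodule.subset_span hs)
    refine le_antisymm (sup_le ?_ (kronFiltration_antitone zero_le_one)) ?_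
    · rw [Submodule.span_le]
      rintro _ ⟨f, hf, rfl⟩
      exact kron_mem_zero fun i => hSL i (hf i)
    · refine Submodule.span_le.2 ?_
      rintro _ ⟨w, -, f, hf, rfl⟩
      have h1 : ∀ i, f i ∈ Submodule.span F (S i ∪ R i) := fun i => by
        rw [Submodule.span_union, Submodule.span_eq, (hS i).sup_eq]
        exact idealPow_le (h i) _ (hf i)
      refine Submodule.span_le.2 ?_ (kron_mem_span _ f h1)
      rintro _ ⟨g, hg, rfl⟩
      by_cases hR : ∃ i, g i ∈ R i
      · obtain ⟨i, hi⟩ := hR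
        exact Submodule.mem_sup_right (kron_mem_one
          (fun j => (hg j).elim (fun hj => hSL j hj) fun hj => (h j).le hj) hi)
      · refine Submodule.mem_sup_left (Submodule.subset_span ⟨g, fun i => ?_, rfl⟩)
        exact (hg i).resolve_right fun hi => hR ⟨i, hi⟩
  isolate := by
    rintro _ ⟨f, hf, rfl⟩ hne
    choose u hu v hv q hq0 hq huv hz using
      fun i => (hS i).isolate (f i) (hf i) (ne_zero_of_kron_ne_zero hne i)
    refine ⟨kron u, kron_mem_zero hu, kron v, kron_mem_zero hv, kron q, kron_ne_zero hq0,
      ?_, ?_, ?_⟩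
    · simp only [kron_mul, hq]
    · simp only [kron_mul, huv]
    · rintro _ ⟨g, hg, rfl⟩ hgf
      obtain ⟨i, hi⟩ : ∃ i, g i ≠ f i := Function.ne_iff.1 fun e => hgf (by rw [e])
      simp only [kron_mul]
      exact kron.map_coord_zero i (hz i _ (hg i) hi)

end TensorFiltration

/-! ### Nilpotent ideals and separating sets -/

section Radical

variable {F A : Type*} [Field F] [Ring A] [Algebra F A]

/-- If `R` is a nilpotent ideal of `L` and some `S` separates `L` modulo `R`, then an element
of `L` outside `R` generates an ideal of `L` that contains a non-nilpotent element: up to a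
nonzero scalar and a summand in `R`, an idempotent outside `R`. -/
theorem Separates.mem_of_forall_isNilpotent {S : Set A} {L R : Submodule F A}
    (hS : Separates S L R) (h : IsIdealOf R L) (hR : ∀ r ∈ R, IsNilpotent r) {t : A}
    (ht : t ∈ L) (hnil : ∀ u ∈ L, ∀ v ∈ L, IsNilpotent (u * t * v)) : t ∈ R := by
  classical
  rw [← hS.sup_eq, Submodule.mem_sup] at ht
  obtain ⟨t, ht, r, hr, rfl⟩ := ht
  obtain ⟨c, hc, rfl⟩ := Submodule.mem_span_set.1 ht
  by_contra hmem
  obtain ⟨s, hs, hsR⟩ : ∃ s ∈ c.support, s ∉ R := by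
    by_contra! hcon
    exact hmem (add_mem (Submodule.sum_mem _ fun s hs => R.smul_mem _ (hcon s hs)) hr)
  obtain ⟨u, hu, v, hv, q, hq0, hq, huv, hz⟩ :=
    hS.isolate s (hc hs) fun h0 => hsR (h0 ▸ zero_mem R)
  have hcs : c s ≠ 0 := Finsupp.mem_support_iff.1 hs
  have hr' : u * r * v ∈ R :=
    h.right (Submodule.mul_mem_mul (h.left (Submodule.mul_mem_mul hu hr)) hv)
  have hexp : u * (c.sum (fun mi r => r • mi) + r) * v = c s • q + u * r * v := by
    rw [mul_add, add_mul, Finsupp.sum, Finset.mul_sum, Finset.sum_mul, Finset.sum_eq_single s]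
    · simp [huv]
    · intro t ht hts
      simp [hz t (hc ht) hts]
    · exact fun h => (h hs).elim
  obtain ⟨N, hN⟩ := hnil u hu v hv
  have hqL : q ∈ L := huv ▸ h.mul_le (Submodule.mul_mem_mul (h.mul_le (Submodule.mul_mem_mul hu
    (hS.sup_eq ▸ Submodule.mem_sup_left (Submodule.subset_span (hc hs))))) hv)
  rw [hexp] at hN
  -- Modulo `R`, the powers of `u * t * v` are nonzero multiples of `q`, so its nilpotency puts the
  -- idempotent `q` into the nil ideal `R`.
  have hpow : ∀ N : ℕ, (c s • q + u * r * v) ^ (N + 1) - c s ^ (N + 1) • q ∈ R := by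
    intro N
    induction N with
    | zero => simpa using hr'
    | succ N ih =>
      have e : (c s • q + u * r * v) ^ (N + 1 + 1) - c s ^ (N + 1 + 1) • q =
          ((c s • q + u * r * v) ^ (N + 1) - c s ^ (N + 1) • q) * (c s • q + u * r * v) +
            c s ^ (N + 1) • (q * (u * r * v)) := by
        rw [sub_mul, ← pow_succ, mul_add (c s ^ (N + 1) • q), pow_succ' (c s) (N + 1)]
        simp only [smul_mul_assoc, mul_smul_comm, hq, smul_smul]
        abel
      rw [e]
      exact add_mem (h.right (Submodule.mul_mem_mul ih
        (add_mem (L.smul_mem _ hqL) (h.le hr')))) (R.smul_mem _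
          (h.left (Submodule.mul_mem_mul hqL hr')))
  have hqR : q ∈ R := by
    have := hpow N
    rw [pow_succ, hN, zero_mul, zero_sub, neg_mem_iff] at this
    exact (R.smul_mem_iff (pow_ne_zero _ hcs)).1 this
  obtain ⟨M, hM⟩ := hR q hqR
  have hqM : q ^ (M + 1) = q := IsIdempotentElem.pow_succ_eq M hq
  rw [pow_succ, hM, zero_mul] at hqM
  exact hq0 hqM.symm

end Radical

/-! ### The Terwilliger algebra of a trivial scheme -/

section Factor

variable (F : Type*) [Field F] {V : Type*} [DecidableEq V] (v : V)

/-- The indicator vector of `{v}` for `a = 0`, and of its complement for `a = 1`. -/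
def ind (a : Fin 2) : V → F := fun y => if (y = v ↔ a = 0) then 1 else 0

/-- The diagonal idempotent of the block `{v}` for `a = 0`, and of its complement for `a = 1`. -/
def blockId (a : Fin 2) : Matrix V V F := Matrix.diagonal (ind F v a)

/-- The all-ones matrix on the rows of the block `a` and the columns of the block `c`. -/
def blockOnes (a c : Fin 2) : Matrix V V F := Matrix.vecMulVec (ind F v a) (ind F v c)

/-- The size of a block, in the field. -/
def blockSize (V : Type*) [Fintype V] (a : Fin 2) : F :=
  if a = 0 then 1 else ((Fintype.card V - 1 : ℕ) : F)

theorem ind_zero : ind F v 0 = Pi.single v 1 := by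
  ext y
  simp [ind, Pi.single_apply]

theorem ind_one_add : ind F v 1 = 1 - Pi.single v 1 := by
  ext y
  by_cases h : y = v <;> simp [ind, h]

theorem ind_mul_ind (a c : Fin 2) :
    (fun y => ind F v a y * ind F v c y) = if a = c then ind F v a else 0 := by
  ext y
  by_cases h : y = v <;> fin_cases a <;> fin_cases c <;> simp [ind, h]

theorem ind_ne_zero [Nontrivial V] (a : Fin 2) : ind F v a ≠ 0 := by
  obtain ⟨w, hw⟩ := exists_ne v
  fin_cases a
  · exact Function.ne_iff.2 ⟨v, by simp [ind]⟩
  · exact Function.ne_iff.2 ⟨w, by simp [ind, hw]⟩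

theorem blockOnes_ne_zero [Nontrivial V] (a c : Fin 2) : blockOnes F v a c ≠ 0 := by
  obtain ⟨y, hy⟩ := Function.ne_iff.1 (ind_ne_zero F v a)
  obtain ⟨z, hz⟩ := Function.ne_iff.1 (ind_ne_zero F v c)
  intro h
  exact mul_ne_zero hy hz (congrFun₂ h y z)

theorem blockId_zero : blockId F v 0 = blockOnes F v 0 0 := by
  ext y z
  simp only [blockId, blockOnes, ind_zero, Matrix.diagonal_apply, Matrix.vecMulVec_apply,
    Pi.single_apply]
  split_ifs <;> simp_all

theorem blockId_zero_add_one : blockId F v 0 + blockId F v 1 = 1 := by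
  rw [blockId, blockId, Matrix.diagonal_add, ← Matrix.diagonal_one]
  congr 1
  ext y
  simp [ind_zero, ind_one_add]

/-- The Terwilliger algebra of the trivial scheme, as the span of its block matrices. -/
def factorAlg : Submodule F (Matrix V V F) :=
  Submodule.span F (Set.range (blockId F v) ∪ {M | ∃ a c, M = blockOnes F v a c})

variable {F v} in
theorem blockId_mem (a : Fin 2) : blockId F v a ∈ factorAlg F v :=
  Submodule.subset_span (Or.inl ⟨a, rfl⟩)

variable {F v} in
theorem blockOnes_mem (a c : Fin 2) : blockOnes F v a c ∈ factorAlg F v :=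
  Submodule.subset_span (Or.inr ⟨a, c, rfl⟩)

variable [Fintype V]

theorem ind_dotProduct_ind (a c : Fin 2) :
    ind F v a ⬝ᵥ ind F v c = if a = c then blockSize F V a else 0 := by
  have h1 : ((Fintype.card V - 1 : ℕ) : F) = Fintype.card V - 1 := by
    rw [Nat.cast_sub (Fintype.card_pos_iff.2 ⟨v⟩), Nat.cast_one]
  fin_cases a <;> fin_cases c <;> simp [ind_zero, ind_one_add, blockSize, h1]

theorem blockId_mul_blockId (a c : Fin 2) :
    blockId F v a * blockId F v c = if a = c then blockId F v a else 0 := by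
  rw [blockId, blockId, Matrix.diagonal_mul_diagonal, ind_mul_ind]
  split_ifs <;> simp

theorem blockId_mul_blockOnes (a b c : Fin 2) :
    blockId F v a * blockOnes F v b c = if a = b then blockOnes F v a c else 0 := by
  have h : blockId F v a * blockOnes F v b c =
      Matrix.vecMulVec (fun y => ind F v a y * ind F v b y) (ind F v c) := by
    ext y z
    simp [blockId, blockOnes, Matrix.vecMulVec_apply, mul_assoc]
  rw [h, ind_mul_ind]
  split_ifs <;> simp [blockOnes]

theorem blockOnes_mul_blockId (a b c : Fin 2) :
    blockOnes F v a b * blockId F v c = if b = c then blockOnes F v a b else 0 := by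
  have h : blockOnes F v a b * blockId F v c =
      Matrix.vecMulVec (ind F v a) (fun y => ind F v b y * ind F v c y) := by
    ext y z
    simp [blockId, blockOnes, Matrix.vecMulVec_apply, mul_assoc]
  rw [h, ind_mul_ind]
  split_ifs <;> simp [blockOnes]

theorem blockOnes_mul_blockOnes (a b c d : Fin 2) :
    blockOnes F v a b * blockOnes F v c d =
      if b = c then blockSize F V b • blockOnes F v a d else 0 := by
  rw [blockOnes, blockOnes, Matrix.vecMulVec_mul_vecMulVec, ind_dotProduct_ind]
  split_ifs
  · ext y z
    simp [blockOnes, Matrix.vecMulVec_apply]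
    ring
  · simp

/-- The radical of `factorAlg`: it is nonzero only when `|V| - 1` vanishes in the field, and then
it is spanned by the all-ones blocks other than the `1 × 1` block. -/
noncomputable def factorRad : Submodule F (Matrix V V F) :=
  open scoped Classical in
  if ((Fintype.card V - 1 : ℕ) : F) = 0 then
    Submodule.span F {M | ∃ a c, (a = 1 ∨ c = 1) ∧ M = blockOnes F v a c}
  else ⊥

variable {F v}

theorem blockOnes_mem_factorRad (hk : ((Fintype.card V - 1 : ℕ) : F) = 0) {a c : Fin 2}
    (h : a = 1 ∨ c = 1) : blockOnes F v a c ∈ factorRad F v := by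
  rw [factorRad, if_pos hk]
  exact Submodule.subset_span ⟨a, c, h, rfl⟩

theorem factorRad_eq_bot (hk : ((Fintype.card V - 1 : ℕ) : F) ≠ 0) : factorRad F v = ⊥ := by
  rw [factorRad, if_neg hk]

theorem isIdealOf_factorRad : IsIdealOf (factorRad F v) (factorAlg F v) := by
  have hmul : factorAlg F v * factorAlg F v ≤ factorAlg F v := by
    conv_lhs => unfold factorAlg
    rw [Submodule.span_mul_span, Submodule.span_le]
    rintro _ ⟨_, ⟨a, rfl⟩ | ⟨a, b, rfl⟩, _, ⟨c, rfl⟩ | ⟨c, d, rfl⟩, rfl⟩ <;>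
      simp only [blockId_mul_blockId, blockId_mul_blockOnes, blockOnes_mul_blockId,
        blockOnes_mul_blockOnes, SetLike.mem_coe] <;>
      split_ifs <;>
      first
        | exact zero_mem _
        | exact blockId_mem _
        | exact blockOnes_mem _ _
        | exact Submodule.smul_mem _ _ (blockOnes_mem _ _)
  have hone : 1 ∈ factorAlg F v := by
    rw [← blockId_zero_add_one F v]
    exact add_mem (blockId_mem _) (blockId_mem _)
  by_cases hk : ((Fintype.card V - 1 : ℕ) : F) = 0
  · have hR : factorRad F v =
        Submodule.span F {M | ∃ a c, (a = 1 ∨ c = 1) ∧ M = blockOnes F v a c} := by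
      rw [factorRad, if_pos hk]
    refine ⟨hone, hmul, ?_, ?_, ?_⟩
    · rw [hR, Submodule.span_le]
      rintro _ ⟨a, c, -, rfl⟩
      exact blockOnes_mem a c
    · conv_lhs => rw [hR, factorAlg]
      rw [Submodule.span_mul_span, Submodule.span_le]
      rintro _ ⟨_, ⟨a, rfl⟩ | ⟨a, b, rfl⟩, _, ⟨c, d, hcd, rfl⟩, rfl⟩ <;>
        simp only [blockId_mul_blockOnes, blockOnes_mul_blockOnes, SetLike.mem_coe] <;>
        split_ifs with h
      · exact blockOnes_mem_factorRad hk (h ▸ hcd)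
      · exact zero_mem _
      · subst h
        by_cases hb : b = 0
        · exact Submodule.smul_mem _ _ (blockOnes_mem_factorRad hk
            (Or.inr (hcd.resolve_left (by simp [hb]))))
        · simp [blockSize, hb, hk]
      · exact zero_mem _
    · conv_lhs => rw [hR, factorAlg]
      rw [Submodule.span_mul_span, Submodule.span_le]
      rintro _ ⟨_, ⟨a, b, hab, rfl⟩, _, ⟨c, rfl⟩ | ⟨c, d, rfl⟩, rfl⟩ <;>
        simp only [blockOnes_mul_blockId, blockOnes_mul_blockOnes, SetLike.mem_coe] <;>
        split_ifs with h
      · exact blockOnes_mem_factorRad hk hab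
      · exact zero_mem _
      · by_cases hb : b = 0
        · exact Submodule.smul_mem _ _ (blockOnes_mem_factorRad hk
            (Or.inl (hab.resolve_right (by simp [hb]))))
        · simp [blockSize, hb, hk]
      · exact zero_mem _
  · rw [factorRad_eq_bot hk]
    exact ⟨hone, hmul, bot_le, by simp, by simp⟩

theorem factorRad_pow_three : factorRad F v ^ 3 = ⊥ := by
  by_cases hk : ((Fintype.card V - 1 : ℕ) : F) = 0
  · have hR : factorRad F v =
        Submodule.span F {M | ∃ a c, (a = 1 ∨ c = 1) ∧ M = blockOnes F v a c} := by
      rw [factorRad, if_pos hk]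
    rw [pow_succ, pow_two, hR, Submodule.span_mul_span, Submodule.span_mul_span,
      Submodule.span_eq_bot]
    rintro _ ⟨_, ⟨_, ⟨a, b, h1, rfl⟩, _, ⟨c, d, h2, rfl⟩, rfl⟩, _, ⟨e, f, h3, rfl⟩, rfl⟩
    -- The middle factor has an index `1`, and contracting that index yields a zero block size.
    simp only [blockOnes_mul_blockOnes]
    fin_cases b <;> fin_cases c <;> fin_cases d <;> fin_cases e <;>
      simp_all [blockSize, blockOnes_mul_blockOnes]
  · rw [factorRad_eq_bot hk]
    simp [Submodule.bot_pow]

/-- If `|V| - 1` vanishes in the field, `factorAlg` modulo its radical is spanned by the two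
diagonal idempotents. -/
theorem separates_of_eq_zero (hk : ((Fintype.card V - 1 : ℕ) : F) = 0) :
    Separates (Set.range (blockId F v)) (factorAlg F v) (factorRad F v) where
  sup_eq := by
    refine le_antisymm (sup_le (Submodule.span_mono Set.subset_union_left)
      isIdealOf_factorRad.le) (Submodule.span_le.2 ?_)
    rintro _ (⟨a, rfl⟩ | ⟨a, c, rfl⟩)
    · exact Submodule.mem_sup_left (Submodule.subset_span ⟨a, rfl⟩)
    · by_cases h : a = 1 ∨ c = 1
      · exact Submodule.mem_sup_right (blockOnes_mem_factorRad hk h)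
      · obtain ⟨rfl, rfl⟩ : a = 0 ∧ c = 0 := by omega
        rw [← blockId_zero]
        exact Submodule.mem_sup_left (Submodule.subset_span ⟨0, rfl⟩)
  isolate := by
    rintro _ ⟨a, rfl⟩ h0
    refine ⟨_, blockId_mem a, _, blockId_mem a, blockId F v a, h0, ?_, ?_, ?_⟩
    · simp [blockId_mul_blockId]
    · simp [blockId_mul_blockId]
    · rintro _ ⟨c, rfl⟩ hc
      have : a ≠ c := fun h => hc (h ▸ rfl)
      simp [blockId_mul_blockId, this]

/-- If `|V| - 1` is invertible in the field, `factorAlg` is the direct sum of a `2 × 2` matrix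
algebra, with the rescaled all-ones blocks as matrix units, and the line of
`blockId 1 - blockOnes 1 1 / (|V| - 1)`, which is zero for `|V| = 2`. -/
theorem separates_of_ne_zero [Nontrivial V] (hk : ((Fintype.card V - 1 : ℕ) : F) ≠ 0) :
    Separates (insert (blockId F v 1 - (blockSize F V 1)⁻¹ • blockOnes F v 1 1)
      {M | ∃ a c, M = (blockSize F V a)⁻¹ • blockOnes F v a c})
      (factorAlg F v) (factorRad F v) := by
  have hs : ∀ a, blockSize F V a ≠ 0 := fun a => by
    rw [blockSize]
    split_ifs
    exacts [one_ne_zero, hk]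
  have hE : ∀ a b c d, ((blockSize F V a)⁻¹ • blockOnes F v a b) *
      ((blockSize F V c)⁻¹ • blockOnes F v c d) =
        if b = c then (blockSize F V a)⁻¹ • blockOnes F v a d else 0 := by
    intro a b c d
    rw [smul_mul_smul_comm, blockOnes_mul_blockOnes]
    split_ifs with h
    · subst h
      rw [smul_smul, mul_assoc, inv_mul_cancel₀ (hs b), mul_one]
    · simp
  have hEm : ∀ a c, (blockSize F V a)⁻¹ • blockOnes F v a c ∈ factorAlg F v := fun a c =>
    Submodule.smul_mem _ _ (blockOnes_mem a c)
  set Z := blockId F v 1 - (blockSize F V 1)⁻¹ • blockOnes F v 1 1 with hZ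
  have hZm : Z ∈ factorAlg F v := sub_mem (blockId_mem 1) (hEm 1 1)
  have hZE : ∀ a c, Z * ((blockSize F V a)⁻¹ • blockOnes F v a c) = 0 := by
    intro a c
    rw [hZ, sub_mul, hE, mul_smul_comm, blockId_mul_blockOnes]
    split_ifs with h
    · simp [h]
    · simp
  have hEZ : ∀ a c, ((blockSize F V a)⁻¹ • blockOnes F v a c) * Z = 0 := by
    intro a c
    rw [hZ, mul_sub, hE, smul_mul_assoc, blockOnes_mul_blockId]
    split_ifs with h
    · simp [h]
    · simp
  have hZZ : Z * Z = Z := by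
    conv_lhs => enter [2]; rw [hZ]
    rw [mul_sub, hZE, sub_zero, hZ, sub_mul, smul_mul_assoc, blockOnes_mul_blockId,
      blockId_mul_blockId]
    simp
  have hone : blockId F v 1 = Z + (blockSize F V 1)⁻¹ • blockOnes F v 1 1 := by simp [hZ]
  clear_value Z
  constructor
  · rw [factorRad_eq_bot hk, sup_bot_eq]
    refine le_antisymm (Submodule.span_le.2 ?_) (Submodule.span_le.2 ?_)
    · rintro _ (rfl | ⟨a, c, rfl⟩)
      exacts [hZm, hEm a c]
    · have hJ : ∀ a c, blockOnes F v a c ∈ Submodule.span F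
          (insert Z {M | ∃ a c, M = (blockSize F V a)⁻¹ • blockOnes F v a c}) := by
        intro a c
        rw [← Submodule.smul_mem_iff _ (inv_ne_zero (hs a))]
        exact Submodule.subset_span (Or.inr ⟨a, c, rfl⟩)
      rintro _ (⟨a, rfl⟩ | ⟨a, c, rfl⟩)
      · fin_cases a
        · simpa [blockId_zero] using hJ 0 0
        · simp only [Fin.mk_one, hone]
          exact add_mem (Submodule.subset_span (Or.inl rfl)) (Submodule.smul_mem _ _ (hJ 1 1))
      · exact hJ a c
  · rintro _ (rfl | ⟨a, c, rfl⟩) h0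
    · refine ⟨_, hZm, _, hZm, _, h0, hZZ, by rw [hZZ, hZZ], ?_⟩
      rintro _ (rfl | ⟨a, c, rfl⟩) hne
      · exact (hne rfl).elim
      · rw [hZE, zero_mul]
    · refine ⟨_, hEm 0 a, _, hEm c 0, (blockSize F V 0)⁻¹ • blockOnes F v 0 0,
        smul_ne_zero (inv_ne_zero (hs 0)) (blockOnes_ne_zero F v 0 0), by simp [hE],
        by simp [hE], ?_⟩
      rintro _ (rfl | ⟨b, d, rfl⟩) hne
      · rw [hEZ, zero_mul]
      · have : ¬ (a = b ∧ d = c) := by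
          rintro ⟨rfl, rfl⟩
          exact hne rfl
        rw [hE]
        split_ifs with hab
        · rw [hE, if_neg fun h => this ⟨hab, h⟩]
        · rw [zero_mul]

end Factor

/-! ### The factorial scheme in coordinates -/

section Scheme

open Matrix

variable {n : ℕ} {U : Fin n → Type*} [∀ a, Fintype (U a)] [∀ a, DecidableEq (U a)]
  [∀ a, Nontrivial (U a)] {F : Type*} [Field F] {x : ∀ a, U a}

omit [∀ a, DecidableEq (U a)] in
theorem mem_scheme_R {g : Fin n → Fin 2} {z : (∀ a, U a) × (∀ a, U a)} :
    z ∈ (scheme U).R g ↔ ∀ i, (z.1 i = z.2 i ↔ g i = 0) := by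
  refine forall_congr' fun i => ?_
  change (z.1 i, z.2 i) ∈ (if g i = 0 then _ else _) ↔ _
  split_ifs with h <;> simp [h]

theorem dualT_eq_kron (g : Fin n → Fin 2) :
    ((scheme U).dualT F x g : Matrix (∀ a, U a) (∀ a, U a) F) =
      kron fun i => blockId F (x i) (g i) := by
  simp only [blockId, kron_diagonal]
  change Matrix.diagonal _ = _
  congr 1
  ext y
  simp only [ind, Finset.prod_ite_zero, mem_scheme_R, Finset.mem_univ, forall_true_left,
    Finset.prod_const_one, eq_comm (a := x _)]

variable (F) in
/-- The adjacency matrices `1` and `J - 1` of the trivial scheme. -/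
def trivialAdj (V : Type*) [DecidableEq V] (j : Fin 2) : Matrix V V F :=
  of fun y z => if (y = z ↔ j = 0) then 1 else 0

theorem adjT_eq_kron (g : Fin n → Fin 2) :
    ((scheme U).adjT F x g : Matrix (∀ a, U a) (∀ a, U a) F) =
      kron fun i => trivialAdj F (U i) (g i) := by
  ext y z
  rw [kron_apply]
  simp only [trivialAdj, AssocScheme.adjT, AssocScheme.adjacency, of_apply, mem_scheme_R,
    Finset.prod_ite_zero, Finset.mem_univ, forall_true_left, Finset.prod_const_one]

variable (F) in
/-- The factor of `B g h i` in a coordinate where `g`, `h`, `i` have the entries `a`, `b`, `c`. -/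
def factorB {V : Type*} [Fintype V] [DecidableEq V] (v : V) (a b c : Fin 2) : Matrix V V F :=
  blockId F v a * (∑ j ∈ {j : Fin 2 | (a ≠ c → j = 1) ∧ (j = 1 → b = 1)}, trivialAdj F V j) *
    blockId F v c

theorem mem_ones {g : Fin n → Fin 2} {a : Fin n} : a ∈ ones g ↔ g a = 1 := by simp [ones]

theorem mem_symmDiff_ones {g h : Fin n → Fin 2} {a : Fin n} :
    a ∈ symmDiff (ones g) (ones h) ↔ g a ≠ h a := by
  rw [Finset.mem_symmDiff, mem_ones, mem_ones]
  omega

/-- The sum over `j` in the definition of `B` runs over a box, so it factors. -/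
theorem B_eq_kron (g h i : Fin n → Fin 2) :
    (B U F x g h i : Matrix (∀ a, U a) (∀ a, U a) F) =
      kron fun a => factorB F (x a) (g a) (h a) (i a) := by
  have hset : Finset.univ.filter (fun j : Fin n → Fin 2 =>
      symmDiff (ones g) (ones i) ⊆ ones j ∧ ones j ⊆ ones h) =
      Fintype.piFinset fun a =>
        ({j : Fin 2 | (g a ≠ i a → j = 1) ∧ (j = 1 → h a = 1)} : Finset (Fin 2)) := by
    ext j
    simp [Finset.subset_iff, mem_symmDiff_ones, mem_ones, forall_and]
  rw [B, hset, AddSubmonoidClass.coe_finsetSum]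
  simp only [MulMemClass.coe_mul, dualT_eq_kron, adjT_eq_kron]
  rw [← Finset.sum_mul, ← Finset.mul_sum, ← kron.map_sum_finset, kron_mul, kron_mul]
  rfl

/-- The condition on the entries of a triple in one coordinate for it to lie in `P`. -/
def FactorInP (V : Type*) [Fintype V] (a b c : Fin 2) : Prop :=
  (a ≠ c → b = 1) ∧ (b = 1 → a ≠ c ∨ (a = 1 ∧ c = 1 ∧ 2 < Fintype.card V))

omit [∀ a, DecidableEq (U a)] [∀ a, Nontrivial (U a)] in
theorem inP_iff {g h i : Fin n → Fin 2} :
    InP U g h i ↔ ∀ a, FactorInP (U a) (g a) (h a) (i a) := by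
  simp only [InP, FactorInP, Finset.subset_iff, Finset.mem_union, big, Finset.mem_filter,
    Finset.mem_inter, mem_symmDiff_ones, mem_ones, forall_and, and_assoc]

section Factor

variable {V : Type*} [Fintype V] [DecidableEq V] {v : V}

theorem blockId_mul_mul_blockId (M : Matrix V V F) (a c : Fin 2) :
    blockId F v a * M * blockId F v c = of fun y z => ind F v a y * M y z * ind F v c z := by
  ext y z
  simp [blockId]

theorem factorB_of_ne {a c : Fin 2} (h : a ≠ c) : factorB F v a 1 c = blockOnes F v a c := by
  have hset : ({j : Fin 2 | (a ≠ c → j = 1) ∧ (j = 1 → (1 : Fin 2) = 1)} : Finset (Fin 2)) =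
      {1} := by
    ext j
    simp [h]
  rw [factorB, hset, Finset.sum_singleton, blockId_mul_mul_blockId]
  ext y z
  by_cases hy : y = v <;> by_cases hz : z = v <;> by_cases hyz : y = z <;> fin_cases a <;>
    fin_cases c <;> simp_all [trivialAdj, ind, blockOnes, vecMulVec_apply]

theorem factorB_zero (a : Fin 2) : factorB F v a 0 a = blockId F v a := by
  have hset : ({j : Fin 2 | (a ≠ a → j = 1) ∧ (j = 1 → (0 : Fin 2) = 1)} : Finset (Fin 2)) =
      {0} := by
    ext j
    simp
    omega
  have h1 : trivialAdj F V 0 = 1 := by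
    ext y z
    simp [trivialAdj, one_apply]
  rw [factorB, hset, Finset.sum_singleton, h1, mul_one, blockId_mul_blockId, if_pos rfl]

theorem factorB_one_one_one : factorB F v 1 1 1 = blockOnes F v 1 1 := by
  have hset : ({j : Fin 2 | ((1 : Fin 2) ≠ 1 → j = 1) ∧ (j = 1 → (1 : Fin 2) = 1)} :
      Finset (Fin 2)) = {0, 1} := by decide
  have h1 : trivialAdj F V 0 + trivialAdj F V 1 = of fun _ _ => 1 := by
    ext y z
    by_cases h : y = z <;> simp [trivialAdj, h]
  rw [factorB, hset, Finset.sum_pair (by decide), h1, blockId_mul_mul_blockId]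
  ext y z
  simp [blockOnes, vecMulVec_apply]

/-- For `|V| = 2` the two matrices supported on the block `(1, 1)` coincide, which is why `P`
contains only one of them. -/
theorem blockOnes_one_one_of_card (h : Fintype.card V = 2) :
    blockOnes F v 1 1 = blockId F v 1 := by
  ext y z
  by_cases hyz : y = z
  · subst hyz
    simp [blockOnes, blockId, vecMulVec_apply, ind]
  · have : y = v ∨ z = v := by
      by_contra! hc
      have h3 : ({v, y, z} : Finset V).card = 3 :=
        Finset.card_eq_three.2 ⟨v, y, z, hc.1.symm, hc.2.symm, hyz, rfl⟩
      have := Finset.card_le_univ ({v, y, z} : Finset V)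
      omega
    rcases this with rfl | rfl <;> simp [blockOnes, blockId, vecMulVec_apply, ind, hyz]

theorem factorB_mem {a b c : Fin 2} (h : FactorInP V a b c) :
    factorB F v a b c ∈ factorAlg F v := by
  by_cases hb : b = 1
  · subst hb
    rcases h.2 rfl with hac | ⟨rfl, rfl, -⟩
    · rw [factorB_of_ne hac]
      exact blockOnes_mem _ _
    · rw [factorB_one_one_one]
      exact blockOnes_mem _ _
  · obtain rfl : b = 0 := by omega
    obtain rfl : a = c := by_contra fun hac => hb (h.1 hac)
    rw [factorB_zero]
    exact blockId_mem _

theorem factorB_mem_factorRad (hk : ((Fintype.card V - 1 : ℕ) : F) = 0) {a c : Fin 2}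
    (h : FactorInP V a 1 c) : factorB F v a 1 c ∈ factorRad F v := by
  rcases h.2 rfl with hac | ⟨rfl, rfl, -⟩
  · rw [factorB_of_ne hac]
    exact blockOnes_mem_factorRad hk (by omega)
  · rw [factorB_one_one_one]
    exact blockOnes_mem_factorRad hk (Or.inl rfl)

theorem factorAlg_le_span [Nontrivial V] : factorAlg F v ≤
    Submodule.span F {M | ∃ a b c, FactorInP V a b c ∧ M = factorB F v a b c} := by
  have hI : ∀ a, blockId F v a ∈
      Submodule.span F {M | ∃ a b c, FactorInP V a b c ∧ M = factorB F v a b c} := fun a =>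
    Submodule.subset_span ⟨a, 0, a, by simp [FactorInP], (factorB_zero a).symm⟩
  refine Submodule.span_le.2 ?_
  rintro _ (⟨a, rfl⟩ | ⟨a, c, rfl⟩)
  · exact hI a
  · by_cases hac : a = c
    · subst hac
      by_cases ha : a = 0
      · subst ha
        rw [← blockId_zero]
        exact hI 0
      · obtain rfl : a = 1 := by omega
        by_cases h2 : 2 < Fintype.card V
        · exact Submodule.subset_span ⟨1, 1, 1, by simp [FactorInP, h2],
            factorB_one_one_one.symm⟩
        · rw [blockOnes_one_one_of_card (by have := Fintype.one_lt_card (α := V); omega)]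
          exact hI 1
    · exact Submodule.subset_span ⟨a, 1, c, by simp [FactorInP, hac], (factorB_of_ne hac).symm⟩

/-- A nonzero radical forces `|V| > 2`, so that the block `(1, 1)` comes from a triple in `P`. -/
theorem factorRad_le_span [Nontrivial V] (hk : ((Fintype.card V - 1 : ℕ) : F) = 0) :
    factorRad F v ≤
      Submodule.span F {M | ∃ a c, FactorInP V a 1 c ∧ M = factorB F v a 1 c} := by
  have h2 : 2 < Fintype.card V := by
    by_contra h
    have : Fintype.card V = 2 := by have := Fintype.one_lt_card (α := V); omega
    simp [this] at hk
  rw [factorRad, if_pos hk]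
  refine Submodule.span_le.2 ?_
  rintro _ ⟨a, c, hac, rfl⟩
  by_cases h : a = c
  · obtain ⟨rfl, rfl⟩ : a = 1 ∧ c = 1 := by omega
    exact Submodule.subset_span ⟨1, 1, by simp [FactorInP, h2], factorB_one_one_one.symm⟩
  · exact Submodule.subset_span ⟨a, c, by simp [FactorInP, h], (factorB_of_ne h).symm⟩

end Factor

omit [∀ a, DecidableEq (U a)] in
theorem valency_eq (g : Fin n → Fin 2) :
    (scheme U).valency g = ∏ a, if g a = 1 then Fintype.card (U a) - 1 else 1 := by
  classical
  have y : ∀ a, U a := fun a => Classical.arbitrary _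
  have h0 : (scheme U).R (scheme U).zero = {z | z.1 = z.2} := (scheme U).diag.choose_spec.1
  have hst : (scheme U).R ((scheme U).star g) = {z | (z.2, z.1) ∈ (scheme U).R g} :=
    ((scheme U).transpose g).choose_spec.1
  have h1 := ((scheme U).regular g ((scheme U).star g) (scheme U).zero).choose_spec y y
    (by rw [h0]; rfl)
  rw [AssocScheme.valency, AssocScheme.interNum, ← h1]
  have h2 : ∀ z, ((y, z) ∈ (scheme U).R g ∧ (z, y) ∈ (scheme U).R ((scheme U).star g)) ↔
      ∀ a, (y a = z a ↔ g a = 0) := by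
    intro z
    rw [hst]
    simp [mem_scheme_R]
  rw [Nat.card_congr ((Equiv.subtypeEquivRight h2).trans
    (Equiv.subtypePiEquivPi (p := fun a (b : U a) => (y a = b ↔ g a = 0)))), Nat.card_pi]
  refine Finset.prod_congr rfl fun a _ => ?_
  rw [Nat.card_eq_fintype_card]
  split_ifs with ha
  · simp [ha, Fintype.card_subtype_compl, eq_comm]
  · have : g a = 0 := by omega
    simp [this]

omit [∀ a, DecidableEq (U a)] in
/-- For `p = 0` both sides say that a positive number is zero, so the case needs no separate
treatment. -/
theorem dvd_valency_iff (F : Type*) [Field F] {p : ℕ} [CharP F p] {g : Fin n → Fin 2} :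
    p ∣ (scheme U).valency g ↔ ∃ a, g a = 1 ∧ ((Fintype.card (U a) - 1 : ℕ) : F) = 0 := by
  rw [← CharP.cast_eq_zero_iff F p, valency_eq, Nat.cast_prod, Finset.prod_eq_zero_iff]
  refine exists_congr fun a => ?_
  split_ifs with h <;> simp [h]

end Scheme

/-! ### The filtration of the Terwilliger algebra -/

section Main

variable {n : ℕ} {U : Fin n → Type*} [∀ a, Fintype (U a)] [∀ a, DecidableEq (U a)]
  {F : Type*} [Field F] {x : ∀ a, U a}

variable (F x) in
/-- The total-degree filtration of the Terwilliger algebra, coming from the radicals of the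
Terwilliger algebras of the trivial schemes. -/
noncomputable def filtration (m : ℕ) : Submodule F (Matrix (∀ a, U a) (∀ a, U a) F) :=
  kronFiltration (fun a => factorAlg F (x a)) (fun a => factorRad F (x a)) m

theorem filtration_mul_mem {m l : ℕ} {M N : Matrix (∀ a, U a) (∀ a, U a) F}
    (hM : M ∈ filtration F x m) (hN : N ∈ filtration F x l) :
    M * N ∈ filtration F x (m + l) :=
  kronFiltration_mul_le (fun _ => isIdealOf_factorRad) m l (Submodule.mul_mem_mul hM hN)

theorem isIdealOf_filtration : IsIdealOf (filtration F x 1) (filtration F x 0) where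
  one_mem := one_mem_kronFiltration fun _ => isIdealOf_factorRad
  mul_le := kronFiltration_mul_le (fun _ => isIdealOf_factorRad) 0 0
  le := kronFiltration_antitone zero_le_one
  left := kronFiltration_mul_le (fun _ => isIdealOf_factorRad) 0 1
  right := kronFiltration_mul_le (fun _ => isIdealOf_factorRad) 1 0

theorem filtration_eq_bot (p : ℕ) [CharP F p] :
    filtration F x
      (2 * (Finset.univ.filter fun a : Fin n => p ∣ Fintype.card (U a) - 1).card + 1) = ⊥ := by
  refine kronFiltration_eq_bot (fun a => if p ∣ Fintype.card (U a) - 1 then 2 else 0)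
    (fun a => ?_) ?_
  · split_ifs with h
    · exact factorRad_pow_three
    · rw [← CharP.cast_eq_zero_iff F p] at h
      rw [factorRad_eq_bot h]
      simp
  · rw [← Finset.sum_filter, Finset.sum_const, smul_eq_mul]
    omega

theorem list_prod_eq_zero (p : ℕ) [CharP F p] {l : List (Matrix (∀ a, U a) (∀ a, U a) F)}
    (hl : ∀ M ∈ l, M ∈ filtration F x 1) (hlen : l.length =
      2 * (Finset.univ.filter fun a : Fin n => p ∣ Fintype.card (U a) - 1).card + 1) :
    l.prod = 0 := by
  have h := list_prod_mem_kronFiltration (fun _ => isIdealOf_factorRad) l hl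
  rw [hlen] at h
  rwa [← Submodule.mem_bot F, ← filtration_eq_bot (x := x) p]

/-- Products of the blocks `(1, 0)` and `(0, 1)` in the coordinates of `D`, two factors per
coordinate, accumulate the block `(1, 1)` in each of them. -/
theorem exists_list_prod_eq (D : Finset (Fin n))
    (hD : ∀ a ∈ D, ((Fintype.card (U a) - 1 : ℕ) : F) = 0) :
    ∃ l : List (Matrix (∀ a, U a) (∀ a, U a) F), l.length = 2 * D.card ∧
      (∀ M ∈ l, M ∈ filtration F x 1) ∧
      l.prod = kron fun a => if a ∈ D then blockOnes F (x a) 1 1 else 1 := by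
  induction D using Finset.induction_on with
  | empty => exact ⟨[], by simp [kron_one]⟩
  | insert b D hb ih =>
    obtain ⟨l, hlen, hl, hprod⟩ := ih fun a ha => hD a (Finset.mem_insert_of_mem ha)
    have hmem : ∀ c d : Fin 2, (c = 1 ∨ d = 1) → kron (Function.update
        (fun a => (1 : Matrix (U a) (U a) F)) b (blockOnes F (x b) c d)) ∈ filtration F x 1 := by
      intro c d hcd
      refine kron_mem_one (i := b) (fun a => ?_) ?_
      · by_cases h : a = b
        · subst h
          simpa using blockOnes_mem c d
        · simpa [h] using isIdealOf_factorRad.one_mem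
      · simpa using blockOnes_mem_factorRad (hD b (Finset.mem_insert_self b D)) hcd
    refine ⟨_ :: _ :: l, ?_, List.forall_mem_cons.2 ⟨hmem 1 0 (Or.inl rfl),
      List.forall_mem_cons.2 ⟨hmem 0 1 (Or.inr rfl), hl⟩⟩, ?_⟩
    · rw [Finset.card_insert_of_notMem hb]
      simp only [List.length_cons, hlen]
      ring
    · rw [List.prod_cons, List.prod_cons, hprod, kron_mul, kron_mul]
      congr 1
      funext a
      by_cases h : a = b
      · subst h
        simp [hb, blockOnes_mul_blockOnes, blockSize]
      · simp [h]

variable [∀ a, Nontrivial (U a)]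

/-- `kron_mem_span` for spans taken inside the Terwilliger algebra. -/
theorem kron_mem_map_span {s : Set (T U F x)} {S : ∀ a, Set (Matrix (U a) (U a) F)}
    (hS : ∀ g, (∀ a, g a ∈ S a) → ∃ t ∈ s, (t : Matrix (∀ a, U a) (∀ a, U a) F) = kron g)
    {f : ∀ a, Matrix (U a) (U a) F} (hf : ∀ a, f a ∈ Submodule.span F (S a)) :
    ∃ t ∈ Submodule.span F s, (t : Matrix (∀ a, U a) (∀ a, U a) F) = kron f := by
  have h : kron f ∈ (Submodule.span F s).map (T U F x).val.toLinearMap := by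
    rw [Submodule.map_span]
    refine Submodule.span_mono ?_ (kron_mem_span S f hf)
    rintro _ ⟨g, hg, rfl⟩
    exact hS g hg
  exact h

theorem trivialAdj_mem {V : Type*} [Fintype V] [DecidableEq V] (v : V) (j : Fin 2) :
    trivialAdj F V j ∈ factorAlg F v := by
  have h1 : trivialAdj F V 0 = 1 := by
    ext y z
    simp [trivialAdj, Matrix.one_apply]
  have h2 : trivialAdj F V 0 + trivialAdj F V 1 = ∑ b, ∑ c, blockOnes F v b c := by
    ext y z
    by_cases hy : y = v <;> by_cases hz : z = v <;> by_cases h : y = z <;>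
      simp_all [trivialAdj, blockOnes, Matrix.vecMulVec_apply, ind, Fin.sum_univ_two]
  have h3 : trivialAdj F V 0 ∈ factorAlg F v := h1 ▸ isIdealOf_factorRad.one_mem
  by_cases hj : j = 0
  · rwa [hj]
  · obtain rfl : j = 1 := by omega
    rw [← sub_eq_of_eq_add' h2.symm]
    exact sub_mem (Submodule.sum_mem _ fun b _ => Submodule.sum_mem _ fun c _ =>
      blockOnes_mem b c) h3

theorem T_le_filtration {M : Matrix (∀ a, U a) (∀ a, U a) F} (hM : M ∈ T U F x) :
    M ∈ filtration F x 0 := by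
  induction hM using Algebra.adjoin_induction with
  | mem M hM =>
    rcases hM with ⟨g, rfl⟩ | ⟨g, rfl⟩
    · rw [show (scheme U).adjacency F g = _ from adjT_eq_kron (x := x) g]
      exact kron_mem_zero fun a => trivialAdj_mem (x a) (g a)
    · rw [show (scheme U).dualIdempotent F x g = _ from dualT_eq_kron g]
      exact kron_mem_zero fun a => blockId_mem (g a)
  | algebraMap r =>
    rw [Algebra.algebraMap_eq_smul_one]
    exact Submodule.smul_mem _ _ isIdealOf_filtration.one_mem
  | add M N _ _ hM hN => exact add_mem hM hN
  | mul M N _ _ hM hN => exact filtration_mul_mem (m := 0) (l := 0) hM hN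

theorem filtration_le_T {M : Matrix (∀ a, U a) (∀ a, U a) F} (hM : M ∈ filtration F x 0) :
    M ∈ T U F x := by
  refine (Submodule.span_le (p := Subalgebra.toSubmodule (T U F x))).2 ?_ hM
  rintro _ ⟨w, -, f, hf, rfl⟩
  obtain ⟨t, -, ht⟩ := kron_mem_map_span (x := x) (s := Set.univ)
    (S := fun a => {M | ∃ b c d, FactorInP (U a) b c d ∧ M = factorB F (x a) b c d})
    (fun g hg => by
      choose b c d _ h using hg
      obtain rfl : g = _ := funext h
      exact ⟨B U F x b c d, trivial, B_eq_kron _ _ _⟩)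
    (f := f) (fun a => by
      have h := idealPow_le isIdealOf_factorRad _ (hf a)
      exact factorAlg_le_span h)
  rw [← ht]
  exact t.2

theorem mem_T_iff {M : Matrix (∀ a, U a) (∀ a, U a) F} : M ∈ T U F x ↔ M ∈ filtration F x 0 :=
  ⟨T_le_filtration, filtration_le_T⟩

theorem mem_spanI_iff (p : ℕ) [CharP F p] {t : T U F x} :
    t ∈ spanI U F x p ↔ (t : Matrix (∀ a, U a) (∀ a, U a) F) ∈ filtration F x 1 := by
  constructor
  · intro ht
    refine (Submodule.span_le (p := (filtration F x 1).comap (T U F x).val.toLinearMap)).2 ?_ ht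
    rintro _ ⟨g, h, i, hP, hp, rfl⟩
    obtain ⟨a, ha, hk⟩ := (dvd_valency_iff F).1 hp
    rw [inP_iff] at hP
    change (B U F x g h i : Matrix (∀ a, U a) (∀ a, U a) F) ∈ filtration F x 1
    rw [B_eq_kron]
    refine kron_mem_one (fun b => factorB_mem (hP b)) (i := a) ?_
    have := hP a
    rw [ha] at this ⊢
    exact factorB_mem_factorRad hk this
  · intro ht
    suffices h : (t : Matrix (∀ a, U a) (∀ a, U a) F) ∈
        (spanI U F x p).map (T U F x).val.toLinearMap by
      obtain ⟨s, hs, hst⟩ := h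
      rwa [← Subtype.ext hst]
    refine Submodule.span_le.2 ?_ ht
    rintro _ ⟨w, hw, f, hf, rfl⟩
    obtain ⟨a, ha⟩ : ∃ a, w a ≠ 0 := by
      by_contra! hc
      simp [hc] at hw
    have hfR : f a ∈ factorRad F (x a) := by
      obtain ⟨k, hk⟩ := Nat.exists_eq_succ_of_ne_zero ha
      have := hf a
      rw [hk] at this
      exact idealPow_succ_le isIdealOf_factorRad k this
    by_cases hk : ((Fintype.card (U a) - 1 : ℕ) : F) = 0
    · refine kron_mem_map_span (S := fun b => {M | ∃ c d e, FactorInP (U b) c d e ∧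
        (b = a → d = 1) ∧ M = factorB F (x b) c d e}) (fun g hg => ?_) fun b => ?_
      · choose b c d hP hc h using hg
        obtain rfl : g = _ := funext h
        exact ⟨B U F x b c d, ⟨b, c, d, inP_iff.2 hP,
          (dvd_valency_iff F).2 ⟨a, hc a rfl, hk⟩, rfl⟩, B_eq_kron _ _ _⟩
      · by_cases hb : b = a
        · subst hb
          refine Submodule.span_mono ?_ (factorRad_le_span hk hfR)
          rintro _ ⟨c, e, h, rfl⟩
          exact ⟨c, 1, e, h, fun _ => rfl, rfl⟩
        · refine Submodule.span_mono ?_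
            (factorAlg_le_span (idealPow_le isIdealOf_factorRad _ (hf b)))
          rintro _ ⟨c, d, e, h, rfl⟩
          exact ⟨c, d, e, h, fun h => (hb h).elim, rfl⟩
    · rw [factorRad_eq_bot hk, Submodule.mem_bot] at hfR
      rw [kron.map_coord_zero a hfR]
      exact zero_mem _

end Main

/-! ### Products of elements of two-sided ideals -/

section TwoSided

variable {A : Type*} [Ring A]

theorem productsVanish_iff_list {I : TwoSidedIdeal A} {m : ℕ} :
    NilpotentIdeal.ProductsVanish I m ↔
      ∀ l : List A, l.length = m → (∀ a ∈ l, a ∈ I) → l.prod = 0 := by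
  constructor
  · rintro h l rfl hl
    simpa using h l.get fun i => hl _ (List.get_mem l i)
  · intro h e he
    exact h _ (by simp) (by simpa [List.mem_ofFn] using he)

theorem isNilpotent_of_isNil {I : TwoSidedIdeal A} (hI : NilpotentIdeal.IsNil I) {a : A}
    (ha : a ∈ I) : IsNilpotent a := by
  obtain ⟨m, -, hm⟩ := hI
  refine ⟨m, ?_⟩
  simpa using productsVanish_iff_list.1 hm (List.replicate m a) (by simp)
    fun b hb => (List.eq_of_mem_replicate hb) ▸ ha

end TwoSided

/-! ### The radical and its nilpotent index -/

section Main

variable {n : ℕ} {U : Fin n → Type*} [∀ a, Fintype (U a)] [∀ a, DecidableEq (U a)]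
  [∀ a, Nontrivial (U a)] {F : Type*} [Field F] {x : ∀ a, U a}

variable (U F x) in
/-- The first term of the filtration, as a two-sided ideal of the Terwilliger algebra. -/
def filtrationIdeal : TwoSidedIdeal (T U F x) :=
  .mk' {t | (t : Matrix (∀ a, U a) (∀ a, U a) F) ∈ filtration F x 1}
    (zero_mem (filtration F x 1)) (fun hs ht => (filtration F x 1).add_mem hs ht)
    (fun ht => (filtration F x 1).neg_mem ht)
    (fun {s _} ht => filtration_mul_mem (m := 0) (mem_T_iff.1 s.2) ht)
    (fun {_ t} hs => filtration_mul_mem (l := 0) hs (mem_T_iff.1 t.2))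

theorem mem_filtrationIdeal {t : T U F x} : t ∈ filtrationIdeal U F x ↔
    (t : Matrix (∀ a, U a) (∀ a, U a) F) ∈ filtration F x 1 :=
  TwoSidedIdeal.mem_mk' ..

theorem productsVanish_filtrationIdeal (p : ℕ) [CharP F p] :
    NilpotentIdeal.ProductsVanish (filtrationIdeal U F x)
      (2 * (Finset.univ.filter fun a : Fin n => p ∣ Fintype.card (U a) - 1).card + 1) := by
  rw [productsVanish_iff_list]
  intro l hlen hl
  refine Subtype.ext ((map_list_prod (T U F x).val l).trans (list_prod_eq_zero p (x := x) ?_ ?_))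
  · simpa using fun t ht htl => mem_filtrationIdeal.1 (hl ⟨t, ht⟩ htl)
  · simpa using hlen

theorem rad_eq_filtrationIdeal : NilpotentIdeal.Rad (T U F x) = filtrationIdeal U F x := by
  obtain ⟨p, _⟩ := CharP.exists F
  have hnil : NilpotentIdeal.IsNil (filtrationIdeal U F x) :=
    ⟨_, Nat.succ_pos _, productsVanish_filtrationIdeal p⟩
  refine le_antisymm (sSup_le fun N hN t ht => ?_) (le_sSup hnil)
  have hS := fun a => (em (((Fintype.card (U a) - 1 : ℕ) : F) = 0)).elim
    (fun hk => (⟨_, separates_of_eq_zero hk⟩ :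
      ∃ S, Separates S (factorAlg F (x a)) (factorRad F (x a))))
    fun hk => ⟨_, separates_of_ne_zero hk⟩
  choose S hS using hS
  have hsep : Separates {M | ∃ f, (∀ a, f a ∈ S a) ∧ kron f = M} (filtration F x 0)
      (filtration F x 1) := separates_kron (fun _ => isIdealOf_factorRad) hS
  rw [mem_filtrationIdeal]
  refine hsep.mem_of_forall_isNilpotent isIdealOf_filtration (fun r hr => ?_)
    (mem_T_iff.1 t.2) ?_
  · have hrT : r ∈ T U F x := mem_T_iff.2 (isIdealOf_filtration.le hr)
    have h := isNilpotent_of_isNil hnil (a := ⟨r, hrT⟩) (mem_filtrationIdeal.2 hr)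
    exact h.map (T U F x).val
  · intro u hu v hv
    have h := isNilpotent_of_isNil hN
      (N.mul_mem_right _ ⟨v, mem_T_iff.2 hv⟩ (N.mul_mem_left ⟨u, mem_T_iff.2 hu⟩ t ht))
    exact h.map (T U F x).val

theorem le_of_productsVanish (p : ℕ) [CharP F p] {m : ℕ}
    (hm : NilpotentIdeal.ProductsVanish (filtrationIdeal U F x) m) :
    2 * (Finset.univ.filter fun a : Fin n => p ∣ Fintype.card (U a) - 1).card + 1 ≤ m := by
  obtain ⟨l, hlen, hl, hprod⟩ := exists_list_prod_eq (F := F) (x := x)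
    (Finset.univ.filter fun a : Fin n => p ∣ Fintype.card (U a) - 1)
    fun a ha => (CharP.cast_eq_zero_iff F p _).2 (Finset.mem_filter.1 ha).2
  by_contra! hlt
  lift l to List (T U F x) using fun M hM =>
    mem_T_iff.2 (isIdealOf_filtration.le (hl M hM))
  rw [List.length_map] at hlen
  have h0 : l.prod = 0 := by
    rw [← List.prod_take_mul_prod_drop l m, productsVanish_iff_list.1 hm (l.take m), zero_mul]
    · rw [List.length_take]
      omega
    · exact fun t ht => mem_filtrationIdeal.2
        (hl _ (List.mem_map_of_mem (List.mem_of_mem_take ht)))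
  refine kron_ne_zero (fun a => ?_) (hprod.symm.trans
    ((map_list_prod (T U F x).val l).symm.trans (congrArg Subtype.val h0)))
  split_ifs
  exacts [blockOnes_ne_zero F (x a) 1 1, one_ne_zero]

end Main

end FactorialScheme

theorem theorem6p9 {F : Type*} [Field F] (p : ℕ) [CharP F p] {n : ℕ} (hn : 0 < n)
    (U : Fin n → Type*) [∀ a, Fintype (U a)] [∀ a, DecidableEq (U a)] [∀ a, Nontrivial (U a)]
    (x : ∀ a, U a) :
    (NilpotentIdeal.Rad (FactorialScheme.T U F x) : Set (FactorialScheme.T U F x)) =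
        (FactorialScheme.spanI U F x p : Set (FactorialScheme.T U F x)) ∧
      NilpotentIdeal.HasIndex (NilpotentIdeal.Rad (FactorialScheme.T U F x))
        (2 * (Finset.univ.filter fun a : Fin n => p ∣ Fintype.card (U a) - 1).card + 1) := by
  rw [FactorialScheme.rad_eq_filtrationIdeal]
  refine ⟨Set.ext fun t => ?_,
    ⟨Nat.succ_pos _, FactorialScheme.productsVanish_filtrationIdeal p⟩,
    fun m hm => FactorialScheme.le_of_productsVanish p hm.2⟩
  exact FactorialScheme.mem_filtrationIdeal.trans (FactorialScheme.mem_spanI_iff p).symm
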